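/- Conventions. A Turing machine has one two-way infinite tape, a finite alphabet and finitely many states. An \emph{$o$-machine} with oracle set $X\subseteq\mathbb{N}$ ($0\in\mathbb{N}$) is a Turing machine with a special query state, two answer states and a special symbol $\mu$. In the query state it passes to the $1$-state if exactly two squares of the tape carry $\mu$ and the number $n$ of squares between them belongs to $X$; otherwise it passes to the $0$-state. A \emph{probabilistic Turing machine (PTM) equipped with probability $p\in[0,1]$} is a Turing machine with a special randomising state, in which it tosses a coin, independently of all earlier tosses, that lands heads with probability $p$; it passes to the specified $1$-state on heads and to the $0$-state on tails. Inputs and outputs are finite tuples of natural numbers, written on the tape in unary (each $x$ as a block of $x+1$ strokes followed by a blank, and read in the same way at halting from the head to the right, up to the first place where no block begins). For $X\subseteq\mathbb{N}$ let $$p_X=\sum_{n\in X}2^{-(n+1)}\in[0,1],$$ the number $0.b_0b_1b_2\ldots$ in base two with $b_n=1$ if $n\in X$ and $b_n=0$ otherwise. Theorem. For every $o$-machine $M$ and every oracle set $X\subseteq\mathbb{N}$ (including those for which $p_X$ is a dyadic rational) there is a PTM $P_M$ such that, when $P_M$ is equipped with probability $p_X$, for every $j\in\mathbb{N}$ and every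 input tuple $(x_1,\ldots,x_n)$ of $M$, the machine $P_M$ on input $(j,x_1,\ldots,x_n)$ produces the same output as $M$ with oracle $X$ on input $(x_1,\ldots,x_n)$ with probability greater than $1-\frac{1}{2^{j}}$. That is: if $M$ halts with output $(y_1,\ldots,y_m)$, then the probability that $P_M$ halts with output $(y_1,\ldots,y_m)$ is greater than $1-2^{-j}$; and if $M$ does not halt, then the probability that $P_M$ does not halt is greater than $1-2^{-j}$. -/

import Mathlib

open MeasureTheory ProbabilityTheory Turing

noncomputable section

namespace BiasedCoin

/-- A standard Turing machine with one two-way infinite tape, a finite alphabet `Γ` and a finite set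
of states `Λ`, together with one distinguished state `ask` and two answer states `one` and `zero`.
The blank is `default : Γ`, the start state is `default : Λ`, and the machine halts when its table
has no entry. The state `ask` is not governed by the table: in it the machine goes to `one` or
to `zero`, according to the answer it is given. The symbol `stroke` is used to write numbers. -/
structure AskingMachine where
  Γ : Type
  Λ : Type
  [inhabitedΓ : Inhabited Γ]
  [finiteΓ : Finite Γ]
  [inhabitedΛ : Inhabited Λ]
  [finiteΛ : Finite Λ]
  table : TM0.Machine Γ Λ
  stroke : Γ
  stroke_ne_blank : stroke ≠ default
  ask : Λ
  one : Λ
  zero : Λ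

attribute [instance] AskingMachine.inhabitedΓ AskingMachine.finiteΓ
  AskingMachine.inhabitedΛ AskingMachine.finiteΛ

/-- Tuples of natural numbers in unary: each `x` is a block of `x + 1` strokes (`true`) followed by
one blank (`false`). -/
def unary (xs : List ℕ) : List Bool :=
  xs.flatMap fun x => List.replicate (x + 1) true ++ [false]

namespace AskingMachine

variable (M : AskingMachine)

/-- State and tape. -/
abbrev Cfg : Type := TM0.Cfg M.Γ M.Λ

/-- The machine in its start state, the tuple `xs` on the tape, the head on the first square of the
tuple, all other squares blank. -/
def init (xs : List ℕ) : M.Cfg :=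
  TM0.init ((unary xs).map fun b => if b then M.stroke else default)

open Classical in
/-- One step, when `answer` is the answer that would be given in the state `ask`. -/
def step (answer : Prop) (c : M.Cfg) : Option M.Cfg :=
  if c.q = M.ask then some ⟨if answer then M.one else M.zero, c.Tape⟩
  else TM0.step M.table c

/-- The tuple read off the tape `T`, from the head to the right, is `ys`: the blocks of strokes,
separated by single other squares, up to the first place where no block begins. Every tape
carries exactly one tuple. -/
def Reads (T : Tape M.Γ) (ys : List ℕ) : Prop :=
  ∀ i : ℕ, i ≤ (unary ys).length → (T.nth (i : ℤ) = M.stroke ↔ (unary ys)[i]? = some true)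

end AskingMachine

/-- An o-machine: in the state `ask` it puts a question to an oracle. The special symbol `mark`
serves to write the question on the tape. -/
structure OMachine extends AskingMachine where
  mark : Γ
  mark_ne_blank : mark ≠ default
  mark_ne_stroke : mark ≠ stroke

namespace OMachine

variable (M : OMachine)

/-- The question written on the tape `T` is `n`: there are exactly two squares that
carry `mark`, and there are `n` squares between them. -/
def Query (T : Tape M.Γ) (n : ℕ) : Prop :=
  ∃ a : ℤ, ∀ k : ℤ, T.nth k = M.mark ↔ k = a ∨ k = a + n + 1

/-- One step with oracle set `X`. -/
def step (X : Set ℕ) (c : M.Cfg) : Option M.Cfg :=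
  M.toAskingMachine.step (∃ n ∈ X, M.Query c.Tape n) c

/-- With oracle set `X` and input `xs`, the machine halts with output `ys`. -/
def Outputs (X : Set ℕ) (xs ys : List ℕ) : Prop :=
  ∃ c ∈ StateTransition.eval (M.step X) (M.init xs), M.Reads c.Tape ys

/-- With oracle set `X` and input `xs`, the machine halts. -/
def Halts (X : Set ℕ) (xs : List ℕ) : Prop :=
  (StateTransition.eval (M.step X) (M.init xs)).Dom

end OMachine

/-- A probabilistic Turing machine: in the state `ask` it tosses its coin. -/
structure PTM extends AskingMachine

namespace PTM

variable (P : PTM)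

/-- One step, on a configuration together with the number of tosses made so far. Here `ω i` says
whether toss number `i` lands heads; heads leads to the state `one`, tails to `zero`. -/
def step (ω : ℕ → Bool) (s : P.Cfg × ℕ) : Option (P.Cfg × ℕ) :=
  open Classical in
  (P.toAskingMachine.step (ω s.2 = true) s.1).map fun c =>
    (c, if s.1.q = P.ask then s.2 + 1 else s.2)

/-- With input `xs` and outcomes `ω` of the tosses, the machine halts with output `ys`. -/
def Outputs (ω : ℕ → Bool) (xs ys : List ℕ) : Prop :=
  ∃ s ∈ StateTransition.eval (P.step ω) (P.init xs, 0), P.Reads s.1.Tape ys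

/-- With input `xs` and outcomes `ω` of the tosses, the machine halts. -/
def Halts (ω : ℕ → Bool) (xs : List ℕ) : Prop :=
  (StateTransition.eval (P.step ω) (P.init xs, 0)).Dom

end PTM

/-- The law of the outcomes of independent tosses of a coin that lands heads (`true`) with
probability `p`. -/
def tosses (p : unitInterval) : Measure (ℕ → Bool) :=
  Measure.infinitePi fun _ => bernoulliMeasure true false p

open Classical in
/-- The number `0.b₀b₁b₂…` in base two, where `bₙ = 1` if `n ∈ X` and `bₙ = 0` otherwise. -/
def bias (X : Set ℕ) : unitInterval :=
  ⟨Real.ofDigits (b := 2) fun n => if n ∈ X then 1 else 0,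
    Real.ofDigits_nonneg _, Real.ofDigits_le_one _⟩

end BiasedCoin

end

open MeasureTheory ProbabilityTheory Turing

noncomputable section

namespace BiasedCoin

open StateTransition Turing.ToPartrec

/-! The frequency of heads reveals the coin's bias, whose binary digits are the answers of the
oracle. By Chebyshev, the frequency among `8 ^ s` tosses misses `p` by at least `2 ^ (-s)` with
probability at most `2 ^ (-s) / 4` (`measure_heads_le`). Summed over `s > j` this stays below `2 ^
(-j)`, so a single exceptional event covers all queries, however many there are
(`lt_measureReal_typical`). This is why computations that never halt are covered too. Outside this
event, digit `n` is read off once the whole interval around the frequency lies between two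
consecutive multiples of `2 ^ (-(n + 1))`. If `X` and its complement are infinite, `p` is no such
multiple, so every digit is eventually decided, and correctly (`reliable_digitDecision`). Otherwise
`X` is finite or cofinite, hence primitive recursive, and is built into the machine
(`reliable_finiteDecision`). The rest is an actual Turing machine. Simulating one step of the
o-machine, given one more toss, is a primitive recursive function on words (`primrec_simWord`). The
translation of partial recursive functions into Turing machines computes it
(`nonempty_wordMachine`), and a hand-made loop around that machine tosses the coin, reads the input
and leaves the output (`loop`). For each fixed sequence of outcomes that admits reliable decisions
the simulation is deterministic and correct (`exists_ptm`). -/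

/-! ### Words of bits as natural numbers -/

/-- The binary number whose digits are a leading one followed by `w`. -/
def wordPos (w : List Bool) : PosNum :=
  w.foldl (fun p b => cond b p.bit1 p.bit0) 1

def wordNum (w : List Bool) : ℕ :=
  (wordPos w : ℕ)

theorem wordPos_concat (w : List Bool) (b : Bool) :
    wordPos (w ++ [b]) = cond b (wordPos w).bit1 (wordPos w).bit0 := by
  simp [wordPos]

theorem wordNum_concat (w : List Bool) (b : Bool) :
    wordNum (w ++ [b]) = 2 * wordNum w + b.toNat := by
  cases b <;> simp [wordNum, wordPos_concat] <;> omega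

theorem wordNum_eq_foldl (w : List Bool) :
    wordNum w = w.foldl (fun n b => 2 * n + b.toNat) 1 := by
  induction w using List.reverseRecOn with
  | nil => simp [wordNum, wordPos]
  | append_singleton w b ih => rw [wordNum_concat, ih]; simp

theorem length_lt_wordNum (w : List Bool) : w.length < wordNum w := by
  induction w using List.reverseRecOn with
  | nil => simp [wordNum, wordPos]
  | append_singleton w b ih => rw [wordNum_concat, List.length_append, List.length_singleton]; omega

/-- Move the last binary digit of the number to the front of the word, except for a leading one. -/
def unbit (s : ℕ × List Bool) : ℕ × List Bool :=
  if s.1 ≤ 1 then s else (s.1 / 2, (s.1 % 2 == 1) :: s.2)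

/-- Iterating `n` times is more than enough, since a word is shorter than its number and `unbit`
stops at the leading one. The leading one preserves initial `false` bits. -/
def numWord (n : ℕ) : List Bool :=
  (unbit^[n] (n, [])).2

theorem unbit_iterate_wordNum (w l : List Bool) (k : ℕ) (hk : w.length ≤ k) :
    unbit^[k] (wordNum w, l) = (1, w ++ l) := by
  induction w using List.reverseRecOn generalizing l k with
  | nil => exact Function.iterate_fixed (by simp [unbit, wordNum, wordPos]) k
  | append_singleton w b ih =>
    have hpos : 1 ≤ wordNum w := (Nat.zero_le _).trans_lt (length_lt_wordNum w)
    rw [List.length_append, List.length_singleton] at hk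
    obtain ⟨k, rfl⟩ := Nat.exists_eq_add_of_le' (show 1 ≤ k by omega)
    have h : unbit (wordNum (w ++ [b]), l) = (wordNum w, b :: l) := by
      rw [unbit, wordNum_concat, if_neg (by simp only; omega)]
      cases b
      · simp
      · simp only [Bool.toNat_true, Prod.mk.injEq, List.cons.injEq, and_true]
        exact ⟨by omega, by simp⟩
    rw [Function.iterate_succ_apply, h, ih _ _ (by omega)]
    simp

theorem numWord_wordNum (w : List Bool) : numWord (wordNum w) = w := by
  rw [numWord, unbit_iterate_wordNum _ _ _ (length_lt_wordNum w).le, List.append_nil]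

theorem primrec_wordNum : Primrec wordNum := by
  have h : Primrec fun w : List Bool => w.foldl (fun n b => 2 * n + b.toNat) 1 :=
    Primrec.list_foldl (h := fun _ (p : ℕ × Bool) => 2 * p.1 + p.2.toNat) Primrec.id (Primrec.const 1)
      (Primrec.nat_add.comp (Primrec.nat_double.comp (Primrec.fst.comp Primrec.snd))
        ((Primrec.dom_finite Bool.toNat).comp (Primrec.snd.comp Primrec.snd))).to₂
  exact h.of_eq fun w => (wordNum_eq_foldl w).symm

theorem primrec_unbit : Primrec unbit := by
  refine Primrec.ite (Primrec.nat_le.comp Primrec.fst (Primrec.const 1)) Primrec.id ?_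
  refine Primrec.pair (Primrec.nat_div.comp Primrec.fst (Primrec.const 2))
    (Primrec.list_cons.comp ?_ Primrec.snd)
  exact Primrec.beq.comp (Primrec.nat_mod.comp Primrec.fst (Primrec.const 2)) (Primrec.const 1)

theorem primrec_numWord : Primrec numWord :=
  Primrec.snd.comp (Primrec.nat_iterate Primrec.id (Primrec.pair Primrec.id (Primrec.const []))
    (primrec_unbit.comp₂ Primrec₂.right))

/-! ### Machines that compute on words -/

/-- A Turing machine that replaces a word `w` of bits, written to the right of a `mark` and
a bit `true`, by `g w`, and returns to the mark. -/
structure WordMachine (g : List Bool → List Bool) where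
  Γ : Type
  Λ : Type
  [inhabitedΓ : Inhabited Γ]
  [finiteΓ : Finite Γ]
  [inhabitedΛ : Inhabited Λ]
  [finiteΛ : Finite Λ]
  table : TM0.Machine Γ Λ
  start : Λ
  final : Λ
  mark : Γ
  bit : Bool → Γ
  bit_ne_blank : ∀ b, bit b ≠ default
  bit_injective : Function.Injective bit
  table_final : ∀ a, table final a = none
  reaches : ∀ w, Reaches (TM0.step table)
    ⟨start, Tape.mk₁ (mark :: bit true :: w.map bit)⟩
    ⟨final, Tape.mk₁ (mark :: bit true :: (g w).map bit)⟩

/-- A Turing machine restricted to a set of states which it does not leave. -/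
def restrict {Γ Λ : Type} [Inhabited Λ] (A : TM0.Machine Γ Λ) (S : Set Λ) [Inhabited S]
    (hS : ∀ {q a q' s}, (q', s) ∈ A q a → q ∈ S → q' ∈ S) : TM0.Machine Γ S :=
  fun q a => (A q a).pmap (fun r h => (⟨r.1, h⟩, r.2)) fun _ hr => hS hr q.2

/-- The translated machines have infinite state types, but their runs stay in a finite support.
Restriction to it gives the finite state set that a `WordMachine` requires. -/
theorem restrict_reaches {Γ Λ : Type} [Inhabited Γ] [Inhabited Λ] (A : TM0.Machine Γ Λ)
    (S : Set Λ) [Inhabited S] (hS : ∀ {q a q' s}, (q', s) ∈ A q a → q ∈ S → q' ∈ S)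
    {c c' : TM0.Cfg Γ Λ} (h : Reaches (TM0.step A) c c') (hc : c.q ∈ S) :
    ∃ hc' : c'.q ∈ S, Reaches (TM0.step (restrict A S hS)) ⟨⟨c.q, hc⟩, c.Tape⟩
      ⟨⟨c'.q, hc'⟩, c'.Tape⟩ := by
  induction h with
  | refl => exact ⟨hc, .refl⟩
  | @tail c₁ c₂ h₁ h₂ ih =>
    obtain ⟨hc₁, h⟩ := ih
    obtain ⟨⟨q', s⟩, hq, rfl⟩ := Option.map_eq_some_iff.1 h₂
    refine ⟨hS hq hc₁, h.tail ?_⟩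
    have : restrict A S hS ⟨c₁.q, hc₁⟩ c₁.Tape.1 = some (⟨q', hS hq hc₁⟩, s) := by
      simp only [restrict, hq, Option.pmap_some]
    simp only [TM0.step, this, Option.map_some, Option.mem_def]

/-- The symbol for a bit on the stacks of Mathlib's evaluator of partial recursive functions. -/
def stackBit (b : Bool) : PartrecToTM2.Γ' :=
  cond b .bit1 .bit0

theorem trNat_wordNum (w : List Bool) :
    PartrecToTM2.trNat (wordNum w) = (w.map stackBit).reverse ++ [.bit1] := by
  have h : ∀ w, PartrecToTM2.trPosNum (wordPos w) = (w.map stackBit).reverse ++ [.bit1] := by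
    intro w
    induction w using List.reverseRecOn with
    | nil => rfl
    | append_singleton w b ih =>
      cases b <;> simp [wordPos_concat, PartrecToTM2.trPosNum, ih, stackBit]
  rw [PartrecToTM2.trNat, ← h]
  exact congrArg PartrecToTM2.trNum (Num.of_to_nat (Num.pos (wordPos w)))

instance : Fintype PartrecToTM2.K' :=
  ⟨{.main, .rev, .aux, .stack}, fun k => by cases k <;> simp⟩

abbrev StackSymbol : Type := TM2to1.Γ' PartrecToTM2.K' fun _ => PartrecToTM2.Γ'

/-- The contents of a square that holds the symbol `a` of the main stack. -/
def onMain (a : PartrecToTM2.Γ') : PartrecToTM2.K' → Option PartrecToTM2.Γ' :=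
  Function.update (fun _ => none) .main (some a)

theorem onMain_injective : Function.Injective onMain := fun a b h => by
  simpa [onMain] using congrFun h .main

/-- When only the main stack is nonempty, the track-by-track condition of the stack simulation
determines the tape. One direction serves the initial tape, the other the final one. -/
theorem eq_mk_map_onMain (l : List PartrecToTM2.Γ')
    (L : ListBlank (PartrecToTM2.K' → Option PartrecToTM2.Γ')) :
    (∀ k, L.map (proj k) =
      ListBlank.mk ((PartrecToTM2.K'.elim l [] [] [] k).map some).reverse) ↔
    L = ListBlank.mk (l.reverse.map onMain) := by
  constructor
  · intro h
    refine ListBlank.ext fun i => funext fun k => ?_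
    rw [TM2to1.stk_nth_val i (h k), ListBlank.nth_mk, List.getI_eq_getElem?_getD,
      List.getElem?_map]
    cases k <;> cases h' : l.reverse[i]? <;> simp [onMain, h'] <;> rfl
  · rintro rfl k
    refine ListBlank.ext fun i => ?_
    rw [ListBlank.map_mk, ListBlank.nth_mk, ListBlank.nth_mk, List.getI_eq_getElem?_getD,
      List.getI_eq_getElem?_getD, List.getElem?_map, List.getElem?_map, ← List.map_reverse,
      List.getElem?_map]
    cases k <;> cases h' : l.reverse[i]? <;> simp [onMain, proj, h'] <;> rfl

/-- The square that holds the symbol `cons` of the main stack, at the bottom. -/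
def stackMark : StackSymbol := (true, onMain .cons)

def stackCell (b : Bool) : StackSymbol := (false, onMain (stackBit b))

/-- Numbers lie on the stack with the least digit on top, and the tape carries the stack from the
bottom up. The two reversals cancel, so the tape reads: the end marker, the leading one, then `w` in
order. -/
theorem addBottom_word (w : List Bool) :
    TM2to1.addBottom (ListBlank.mk
      ((PartrecToTM2.trList [wordNum w]).reverse.map onMain)) =
    ListBlank.mk (stackMark :: stackCell true :: w.map stackCell) := by
  simp only [PartrecToTM2.trList, trNat_wordNum, TM2to1.addBottom, List.reverse_append,
    List.reverse_cons, List.reverse_nil, List.nil_append, List.reverse_reverse,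
    List.append_assoc, List.cons_append, List.map_cons, List.map_map,
    ListBlank.head_mk, ListBlank.tail_mk, List.headI_cons, List.tail_cons, ListBlank.map_mk]
  have h : w.map stackCell = ((w.map (onMain ∘ stackBit)).map (Prod.mk false) :) := by
    rw [List.map_map]; rfl
  rw [h]
  exact ListBlank.cons_mk (Γ := StackSymbol) _ _

theorem exists_code_word {g : List Bool → List Bool} (hg : Computable g) :
    ∃ c : Code, ∀ w, c.eval [wordNum w] = pure [wordNum (g w)] := by
  have h : Computable fun n => wordNum (g (numWord n)) :=
    primrec_wordNum.to_comp.comp (hg.comp primrec_numWord.to_comp)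
  obtain ⟨c, hc⟩ := Code.exists_code (Nat.Partrec'.part_iff₁.2 h)
  refine ⟨c, fun w => ?_⟩
  have := hc ⟨[wordNum w], rfl⟩
  simpa [numWord_wordNum, List.Vector.head] using this

/-- A code for `g` on numbers is run as a machine with four stacks, then as a one-tape machine, then
as a table. Both ends of the run have only the main stack in use, which fixes the whole tape. -/
theorem nonempty_wordMachine {g : List Bool → List Bool} (hg : Computable g) :
    Nonempty (WordMachine g) := by
  obtain ⟨c, hc⟩ := exists_code_word hg
  -- The support lemmas speak of the default label, which must be the entry label of `c`.
  let iΛ : Inhabited PartrecToTM2.Λ' := ⟨PartrecToTM2.trNormal c .halt⟩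
  let A₁ := TM2to1.tr PartrecToTM2.tr
  let A := TM1to0.tr A₁
  have hsupp := TM1to0.tr_supports A₁ (TM2to1.tr_supports PartrecToTM2.tr
    (PartrecToTM2.tr_supports c .halt))
  generalize hS : TM1to0.trStmts A₁ (TM2to1.trSupp PartrecToTM2.tr
    (PartrecToTM2.codeSupp c .halt)) = S at hsupp
  let start : TM1to0.Λ' A₁ :=
    (some (A₁ (.normal (PartrecToTM2.trNormal c .halt))), none)
  let final : TM1to0.Λ' A₁ := (none, none)
  have hreach : ∀ w, Reaches (TM0.step A)
      ⟨start, Tape.mk₁ (stackMark :: stackCell true :: w.map stackCell)⟩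
      ⟨final, Tape.mk₁ (stackMark :: stackCell true :: (g w).map stackCell)⟩ := by
    intro w
    have h2 : PartrecToTM2.halt [wordNum (g w)] ∈
        eval (TM2.step PartrecToTM2.tr) (PartrecToTM2.init c [wordNum w]) := by
      rw [PartrecToTM2.tr_eval, hc]
      exact Part.mem_map _ (Part.mem_some _)
    have h2' := (mem_eval.1 h2).1
    obtain ⟨d, hd, h1⟩ := tr_reaches (TM2to1.tr_respects PartrecToTM2.tr)
      (TM2to1.TrCfg.mk _ ((eq_mk_map_onMain _ _).2 rfl)) h2'
    obtain ⟨e, he, h0⟩ := tr_reaches (TM1to0.tr_respects A₁) rfl h1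
    generalize hH : PartrecToTM2.halt [wordNum (g w)] = H at hd
    obtain ⟨L, hL⟩ := hd
    cases hH
    rw [eq_mk_map_onMain] at hL
    subst he hL
    simp only [TM1to0.trCfg, addBottom_word] at h0
    exact h0
  have hstart : start ∈ (S : Set (TM1to0.Λ' A₁)) := hsupp.1
  have hfinal : final ∈ (S : Set (TM1to0.Λ' A₁)) := by
    subst hS
    exact Finset.mem_product.2 ⟨by simp [final, TM1.stmts], Finset.mem_univ _⟩
  let : Inhabited (S : Set (TM1to0.Λ' A₁)) := ⟨⟨start, hstart⟩⟩
  refine ⟨{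
    Γ := StackSymbol
    Λ := (S : Set (TM1to0.Λ' A₁))
    finiteΛ := S.finite_toSet
    table := restrict A S hsupp.2
    start := ⟨start, hstart⟩
    final := ⟨final, hfinal⟩
    mark := stackMark
    bit := stackCell
    bit_ne_blank := fun b h => ?_
    bit_injective := fun a b h => ?_
    table_final := fun a => rfl
    reaches := fun w => (restrict_reaches A S hsupp.2 (hreach w) hstart).2 }⟩
  · have := congrFun (congrArg Prod.snd h) PartrecToTM2.K'.main
    simp [stackCell, onMain] at this
  · have := onMain_injective (congrArg Prod.snd h)
    revert this
    cases a <;> cases b <;> simp [stackBit]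

/-! ### Tapes given by two lists -/

section tapes

variable {Γ : Type} [Inhabited Γ]

/-- The tape with the head on the first square of `R`, and with `L` to the left of the head,
nearest square first. -/
def listTape (L R : List Γ) : Tape Γ :=
  Tape.mk' (ListBlank.mk L) (ListBlank.mk R)

theorem mk₁_eq_listTape (l : List Γ) : Tape.mk₁ l = listTape [] l := rfl

@[simp] theorem listTape_head (L R : List Γ) : (listTape L R).head = R.headI := rfl

@[simp] theorem listTape_move_right (L R : List Γ) :
    (listTape L R).move .right = listTape (R.headI :: L) R.tail := by
  simp [listTape, Tape.move_right_mk']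

@[simp] theorem listTape_move_left (L R : List Γ) :
    (listTape L R).move .left = listTape L.tail (L.headI :: R) := by
  simp [listTape, Tape.move_left_mk']

@[simp] theorem listTape_write (L R : List Γ) (a : Γ) :
    (listTape L R).write a = listTape L (a :: R.tail) := by
  cases R <;> simp [listTape, Tape.write_mk']

theorem listTape_nth (L R : List Γ) (n : ℕ) : (listTape L R).nth n = R[n]?.getD default := by
  rw [listTape, Tape.mk'_nth_nat, ListBlank.nth_mk, List.getI_eq_getElem?_getD]

end tapes

/-! ### A loop around a machine on words, with a toss in every round -/

/-- The states of the loop outside the machine on words. -/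
inductive LoopState
  | scan | fill | test | back | digit | left | lead | mark
  | skip | flag | halt | ask | heads | tails | erase | again

instance : Finite LoopState :=
  Finite.of_injective (β := Fin 16) (fun
    | .scan => 0 | .fill => 1 | .test => 2 | .back => 3 | .digit => 4 | .left => 5 | .lead => 6
    | .mark => 7 | .skip => 8 | .flag => 9 | .halt => 10 | .ask => 11 | .heads => 12
    | .tails => 13 | .erase => 14 | .again => 15)
    fun a b h => by cases a <;> cases b <;> first | rfl | exact absurd h (by decide)

namespace WordMachine

variable {g : List Bool → List Bool} (W : WordMachine g)

attribute [instance] inhabitedΓ finiteΓ inhabitedΛ finiteΛ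

instance : Inhabited (LoopState ⊕ W.Λ) := ⟨.inl .test⟩

-- From `test` to `mark` the input is prepared: the blanks after the blocks become `bit false`, and
-- the mark, the leading one and a first bit are put on the left. A blank met in `test` ends the
-- tuple, as no block begins there. From `skip` to `again` the first bit of the result is inspected
-- and, if need be, replaced by a toss. Where the inner table has no entry, the loop takes over.
open Classical in
def loopTable : TM0.Machine W.Γ (LoopState ⊕ W.Λ)
  | .inl .test, a =>
    some (if a = W.bit true then (.inl .scan, .move .right) else (.inl .back, .move .left))
  | .inl .scan, a =>
    some (if a = W.bit true then (.inl .scan, .move .right) else (.inl .fill, .write (W.bit false)))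
  | .inl .fill, _ => some (.inl .test, .move .right)
  | .inl .back, a =>
    some (if a = default then (.inl .digit, .write (W.bit false)) else (.inl .back, .move .left))
  | .inl .digit, _ => some (.inl .left, .move .left)
  | .inl .left, _ => some (.inl .lead, .write (W.bit true))
  | .inl .lead, _ => some (.inl .mark, .move .left)
  | .inl .mark, _ => some (.inr W.start, .write W.mark)
  | .inl .skip, _ => some (.inl .flag, .move .right)
  | .inl .flag, a =>
    some (if a = W.bit true then (.inl .halt, .move .right) else (.inl .ask, .write a))
  | .inl .halt, _ => none
  | .inl .ask, _ => none
  | .inl .heads, _ => some (.inl .erase, .write (W.bit true))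
  | .inl .tails, _ => some (.inl .erase, .write (W.bit false))
  | .inl .erase, _ => some (.inl .again, .move .left)
  | .inl .again, _ => some (.inr W.start, .move .left)
  | .inr q, a =>
    match W.table q a with
    | none => some (.inl .skip, .move .right)
    | some (q', s) => some (.inr q', s)

/-- The input tuple, as a word after the bit `false`, is the first word. In each round the next
word is computed. If its first bit is `true` then the machine halts on the rest; otherwise
its first bit is replaced by the outcome of a toss. -/
def loop : PTM where
  Γ := W.Γ
  Λ := LoopState ⊕ W.Λ
  table := W.loopTable
  stroke := W.bit true
  stroke_ne_blank := W.bit_ne_blank true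
  ask := .inl .ask
  one := .inl .heads
  zero := .inl .tails

variable (ω : ℕ → Bool) (t : ℕ)

abbrev LoopCfg : Type := TM0.Cfg W.Γ (LoopState ⊕ W.Λ)

open Classical in
/-- One step of the loop. -/
def loopStep (s : W.LoopCfg × ℕ) : Option (W.LoopCfg × ℕ) :=
  if s.1.q = .inl .ask then some (⟨.inl (if ω s.2 then .heads else .tails), s.1.Tape⟩, s.2 + 1)
  else (TM0.step W.loopTable s.1).map fun c => (c, s.2)

theorem loop_step : W.loop.step ω = W.loopStep ω := by
  funext s
  obtain ⟨⟨q, T⟩, t⟩ := s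
  by_cases hq : q = W.loop.ask
  · subst hq
    simp only [PTM.step, AskingMachine.step, if_true, Option.map_some]
    refine Eq.trans ?_ (if_pos rfl).symm
    cases ω t <;> simp <;> rfl
  · simp only [PTM.step, AskingMachine.step, if_neg hq]
    exact (if_neg hq).symm

/-- The configuration at the beginning of a round. -/
def roundCfg (w : List Bool) : W.LoopCfg :=
  ⟨.inr W.start, listTape [] (W.mark :: W.bit true :: w.map W.bit)⟩

theorem step_of_ne_ask {c : W.LoopCfg} (h : c.q ≠ .inl .ask) :
    W.loopStep ω (c, t) = (TM0.step W.loopTable c).map fun c' => (c', t) :=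
  if_neg h

theorem step_ask (T : Tape W.Γ) :
    W.loopStep ω (⟨.inl .ask, T⟩, t) =
      some (⟨.inl (if ω t then .heads else .tails), T⟩, t + 1) :=
  if_pos rfl

theorem step_move {q q' : LoopState ⊕ W.Λ} {T : Tape W.Γ} {d : Dir} (hq : q ≠ .inl .ask)
    (h : W.loopTable q T.head = some (q', .move d)) :
    (⟨q', T.move d⟩, t) ∈ W.loopStep ω (⟨q, T⟩, t) := by
  rw [step_of_ne_ask W ω t hq]
  simp [TM0.step, h]

theorem step_write {q q' : LoopState ⊕ W.Λ} {T : Tape W.Γ} {a : W.Γ} (hq : q ≠ .inl .ask)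
    (h : W.loopTable q T.head = some (q', .write a)) :
    (⟨q', T.write a⟩, t) ∈ W.loopStep ω (⟨q, T⟩, t) := by
  rw [step_of_ne_ask W ω t hq]
  simp [TM0.step, h]

theorem scan_reaches (k : ℕ) (L R : List W.Γ) :
    Reaches (W.loopStep ω)
      (⟨.inl .scan, listTape L (List.replicate k (W.bit true) ++ R)⟩, t)
      (⟨.inl .scan, listTape (List.replicate k (W.bit true) ++ L) R⟩, t) := by
  induction k generalizing L with
  | zero => exact .refl
  | succ k ih =>
    refine .head (step_move W ω t (q' := .inl .scan) (d := .right) (by simp)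
      (by simp [loopTable, List.replicate_succ])) ?_
    have := ih (W.bit true :: L)
    rw [List.append_cons, ← List.replicate_succ'] at this
    change Reaches (W.loopStep ω) _ _
    simpa [List.replicate_succ] using this

theorem test_reaches (xs : List ℕ) (L : List W.Γ) :
    Reaches (W.loopStep ω)
      (⟨.inl .test, listTape L ((unary xs).map fun b => if b then W.bit true else default)⟩, t)
      (⟨.inl .test, listTape (((unary xs).map W.bit).reverse ++ L) []⟩, t) := by
  induction xs generalizing L with
  | nil => exact .refl
  | cons x xs ih =>
    have hu : unary (x :: xs) = true :: (List.replicate x true ++ false :: unary xs) := by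
      simp [unary, List.replicate_succ]
    refine .head (step_move W ω t (q' := .inl .scan) (d := .right) (by simp)
      (by simp [loopTable, hu])) ?_
    simp only [hu, List.map_cons, List.map_append, List.map_replicate, if_true,
      listTape_move_right, List.headI_cons, List.tail_cons, Bool.false_eq_true, if_false]
    refine (scan_reaches W ω t _ _ _).trans ?_
    refine .head (step_write W ω t (q' := .inl .fill) (a := W.bit false) (by simp)
      (by simp [loopTable, (W.bit_ne_blank true).symm])) ?_
    refine .head (step_move W ω t (q' := .inl .test) (d := .right) (by simp) rfl) ?_
    have := ih (W.bit false :: (List.replicate x (W.bit true) ++ W.bit true :: L))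
    change Reaches (W.loopStep ω) _ _
    simpa using this

/-- Every square of the tuple now carries a bit, and bits are not blank, so the first blank met is
the square to the left of the tuple. -/
theorem back_reaches (l : List Bool) (R : List W.Γ) :
    Reaches (W.loopStep ω)
      (⟨.inl .back, (listTape (l.map W.bit) R).move .left⟩, t)
      (⟨.inl .back, listTape [] (default :: ((l.map W.bit).reverse ++ R))⟩, t) := by
  induction l generalizing R with
  | nil => rw [listTape_move_left]; exact .refl
  | cons b l ih =>
    refine .head (step_move W ω t (q' := .inl .back) (d := .left) (by simp)
      (by simp [loopTable, W.bit_ne_blank b])) ?_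
    have := ih (W.bit b :: R)
    change Reaches (W.loopStep ω) _ _
    simpa using this

theorem init_reaches (xs : List ℕ) :
    Reaches (W.loopStep ω) ((W.loop.init xs : W.LoopCfg), t) (W.roundCfg (false :: unary xs), t) := by
  refine (test_reaches W ω t xs []).trans ?_
  refine .head (step_move W ω t (q' := .inl .back) (d := .left) (by simp)
    (by simp [loopTable, (W.bit_ne_blank true).symm])) ?_
  rw [List.append_nil, ← List.map_reverse]
  refine (back_reaches W ω t _ _).trans ?_
  refine .head (step_write W ω t (q' := .inl .digit) (a := W.bit false) (by simp)
    (by simp [loopTable])) ?_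
  refine .head (step_move W ω t (q' := .inl .left) (d := .left) (by simp) rfl) ?_
  refine .head (step_write W ω t (q' := .inl .lead) (a := W.bit true) (by simp) rfl) ?_
  refine .head (step_move W ω t (q' := .inl .mark) (d := .left) (by simp) rfl) ?_
  refine .head (step_write W ω t (q' := .inr W.start) (a := W.mark) (by simp) rfl) ?_
  simp only [listTape_move_left, listTape_write, List.tail_cons, List.map_reverse,
    List.reverse_reverse, List.append_nil]
  exact .refl

theorem run_reaches {c c' : TM0.Cfg W.Γ W.Λ} (h : Reaches (TM0.step W.table) c c') :
    Reaches (W.loopStep ω) (⟨.inr c.q, c.Tape⟩, t) (⟨.inr c'.q, c'.Tape⟩, t) := by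
  refine Relation.ReflTransGen.lift (fun c : TM0.Cfg W.Γ W.Λ => ((⟨.inr c.q, c.Tape⟩, t) :
    W.LoopCfg × ℕ)) (fun a b hab => ?_) _ _ h
  obtain ⟨⟨q', s⟩, hq, rfl⟩ := Option.map_eq_some_iff.1 hab
  have : W.loopTable (.inr a.q) a.Tape.1 = some (.inr q', s) := by
    simp only [loopTable, hq]
  cases s with
  | move d => exact step_move W ω t (by simp) this
  | write x => exact step_write W ω t (by simp) this

theorem round_reaches (w : List Bool) :
    Reaches₁ (W.loopStep ω) (W.roundCfg w, t)
      (⟨.inl .flag, listTape [W.bit true, W.mark] ((g w).map W.bit)⟩, t) := by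
  have h := run_reaches W ω t (W.reaches w)
  refine Relation.TransGen.tail' (h.tail (step_move W ω t (q' := .inl .skip) (d := .right)
    (by simp) (by simp [loopTable, W.table_final]))) ?_
  have := step_move W ω t (q := .inl .skip) (q' := .inl .flag) (d := .right)
    (T := listTape [W.mark] (W.bit true :: (g w).map W.bit)) (by simp) rfl
  simpa [mk₁_eq_listTape] using this

/-- A round that does not halt. -/
theorem roundCfg_reaches₁ {w w' : List Bool} (h : g w = false :: w') :
    Reaches₁ (W.loopStep ω) (W.roundCfg w, t) (W.roundCfg (ω t :: w'), t + 1) := by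
  refine (round_reaches W ω t w).trans_left ?_
  rw [h]
  refine .head (step_write W ω t (q' := .inl .ask) (a := W.bit false) (by simp)
    (by simp [loopTable, W.bit_injective.eq_iff])) ?_
  refine .head (step_ask W ω t _) ?_
  refine .head (b := (⟨.inl .erase, listTape [W.bit true, W.mark] ((ω t :: w').map W.bit)⟩, t + 1))
    ?_ ?_
  · cases hω : ω t
    · exact step_write W ω (t + 1) (q' := .inl .erase) (a := W.bit false) (by simp) rfl
    · exact step_write W ω (t + 1) (q' := .inl .erase) (a := W.bit true) (by simp) rfl
  refine .head (step_move W ω _ (q' := .inl .again) (d := .left) (by simp) rfl) ?_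
  refine .head (step_move W ω _ (q' := .inr W.start) (d := .left) (by simp) rfl) ?_
  simp only [listTape_move_left, List.tail_cons, List.headI_cons]
  exact .refl

/-- A round that halts. -/
theorem roundCfg_eval {w w' : List Bool} (h : g w = true :: w') :
    ∃ L, ((⟨.inl .halt, listTape L (w'.map W.bit)⟩, t) : W.LoopCfg × ℕ) ∈
      eval (W.loopStep ω) (W.roundCfg w, t) := by
  refine ⟨[W.bit true, W.bit true, W.mark], mem_eval.2 ⟨?_, ?_⟩⟩
  · refine (round_reaches W ω t w).to_reflTransGen.tail ?_
    rw [h]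
    exact step_move W ω t (q' := .inl .halt) (d := .right) (by simp) (by simp [loopTable])
  · rw [step_of_ne_ask W ω t (by simp)]
    rfl

theorem listTape_reads (L : List W.Γ) (w : List Bool) (ys : List ℕ) :
    W.loop.Reads (listTape L (w.map W.bit)) ys ↔
      ∀ i ≤ (unary ys).length, w[i]? = some true ↔ (unary ys)[i]? = some true := by
  refine forall₂_congr fun i _ => ?_
  have : (listTape L (w.map W.bit)).nth (i : ℤ) = W.bit true ↔ w[i]? = some true := by
    rw [listTape_nth, List.getElem?_map]
    rcases w[i]? with - | b
    · simpa using (W.bit_ne_blank true).symm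
    · simpa using W.bit_injective.eq_iff
  exact iff_congr this Iff.rfl

end WordMachine

/-! ### Squares of a tape given by two lists -/

section tapes

variable {Γ : Type}

theorem listTape_nth_int [Inhabited Γ] (L R : List Γ) (k : ℤ) :
    (listTape L R).nth k =
      if 0 ≤ k + L.length then (L.reverse ++ R)[(k + L.length).toNat]?.getD default
      else default := by
  induction L generalizing R k with
  | nil =>
    split_ifs with h
    · obtain ⟨n, rfl⟩ := Int.eq_ofNat_of_zero_le (a := k) (by simpa using h)
      rw [listTape_nth]
      simp
    · obtain ⟨n, rfl⟩ := Int.eq_negSucc_of_lt_zero (a := k) (by simpa using h)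
      rfl
  | cons a L ih =>
    have h := Tape.move_left_nth (listTape (a :: L) R) (k + 1)
    rw [add_sub_cancel_right, listTape_move_left] at h
    rw [← h, List.tail_cons, List.headI_cons, ih, List.length_cons, List.reverse_cons,
      List.append_assoc, List.singleton_append]
    push_cast
    simp only [add_assoc, add_comm (1 : ℤ)]

open Classical in
/-- The places of the symbol `a` in the word `w`. -/
def places (w : List Γ) (a : Γ) : List ℕ :=
  (List.range w.length).filter fun i => w[i]? = some a

theorem mem_places {w : List Γ} {a : Γ} {i : ℕ} : i ∈ places w a ↔ w[i]? = some a := by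
  classical
  simp only [places, List.mem_filter, List.mem_range, decide_eq_true_eq, and_iff_right_iff_imp]
  exact fun h => (List.getElem?_eq_some_iff.1 h).1

theorem pairwise_places (w : List Γ) (a : Γ) : (places w a).Pairwise (· < ·) :=
  List.pairwise_lt_range.filter _

/-- The number between the only two places of `a` in the word `w`. -/
def gap (w : List Γ) (a : Γ) : Option ℕ :=
  if (places w a).length = 2 then
    some ((places w a).getD 1 0 - (places w a).getD 0 0 - 1)
  else none

theorem gap_eq_some_iff {w : List Γ} {a : Γ} {n : ℕ} :
    gap w a = some n ↔ ∃ i, places w a = [i, i + n + 1] := by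
  constructor
  · intro h
    rw [gap] at h
    split_ifs at h with h2
    obtain ⟨i, j, hij⟩ := List.length_eq_two.1 h2
    have hlt := pairwise_places w a
    rw [hij] at h hlt ⊢
    simp at h hlt
    exact ⟨i, by congr 2; omega⟩
  · rintro ⟨i, hi⟩
    simp [gap, hi]
    omega

/-- A symbol other than the blank occurs only in the listed part of the tape, so a finite search
settles the question. Increasing lists with the same members are equal, which identifies the list of
places. -/
theorem exists_nth_eq_iff [Inhabited Γ] {a : Γ} (ha : a ≠ default) (L R : List Γ) (n : ℕ) :
    (∃ i : ℤ, ∀ k : ℤ, (listTape L R).nth k = a ↔ k = i ∨ k = i + n + 1) ↔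
      gap (L.reverse ++ R) a = some n := by
  have key : ∀ k : ℤ, (listTape L R).nth k = a ↔
      ∃ m : ℕ, m ∈ places (L.reverse ++ R) a ∧ k = m - L.length := by
    intro k
    rw [listTape_nth_int]
    constructor
    · intro h
      split_ifs at h with h0
      · refine ⟨(k + L.length).toNat, ?_, by omega⟩
        rw [mem_places]
        cases h' : (L.reverse ++ R)[(k + L.length).toNat]? with
        | none => rw [h'] at h; exact absurd h.symm ha
        | some b => rw [h'] at h; exact congrArg some h
      · exact absurd h.symm ha
    · rintro ⟨m, hm, rfl⟩
      rw [if_pos (by omega), show ((m : ℤ) - L.length + L.length).toNat = m by omega,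
        mem_places.1 hm]
      rfl
  rw [gap_eq_some_iff]
  constructor
  · rintro ⟨i, hi⟩
    obtain ⟨m, hm, rfl⟩ := (key i).1 ((hi i).2 (.inl rfl))
    refine ⟨m, List.Pairwise.eq_of_mem_iff (pairwise_places _ _) (by simp) fun l => ?_⟩
    have := hi (l - L.length)
    rw [key] at this
    constructor
    · intro hl
      have := this.1 ⟨l, hl, rfl⟩
      simp
      omega
    · intro hl
      obtain ⟨l', hl', h⟩ := this.2 (by simp at hl; omega)
      rwa [show l = l' by omega]
  · rintro ⟨i, hi⟩
    refine ⟨i - L.length, fun k => ?_⟩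
    rw [key, hi]
    constructor
    · rintro ⟨m, hm, rfl⟩
      simp at hm
      omega
    · rintro (rfl | rfl)
      · exact ⟨i, by simp, rfl⟩
      · exact ⟨i + n + 1, by simp, by push_cast; ring⟩

theorem primrec_places [Primcodable Γ] : Primrec₂ (places (Γ := Γ)) := by
  classical
  have h : PrimrecRel fun (i : ℕ) (p : List Γ × Γ) => p.1[i]? = some p.2 :=
    Primrec.eq.comp (Primrec.list_getElem?.comp (Primrec.fst.comp Primrec.snd) Primrec.fst)
      (Primrec.option_some.comp (Primrec.snd.comp Primrec.snd))
  refine (h.listFilter.comp (Primrec.list_range.comp (Primrec.list_length.comp Primrec.fst))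
    Primrec.id).of_eq fun p => ?_
  exact List.filter_congr fun i _ => by simp

theorem primrec_gap [Primcodable Γ] : Primrec₂ (gap (Γ := Γ)) := by
  have hp : Primrec fun p : List Γ × Γ => places p.1 p.2 := primrec_places
  have hd : ∀ i, Primrec fun p : List Γ × Γ => (places p.1 p.2).getD i 0 := fun i =>
    (Primrec.list_getD 0).comp hp (Primrec.const i)
  exact Primrec.ite (Primrec.eq.comp (Primrec.list_length.comp hp) (Primrec.const 2))
    (Primrec.option_some.comp
      (Primrec.nat_sub.comp (Primrec.nat_sub.comp (hd 1) (hd 0)) (Primrec.const 1)))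
    (Primrec.const none)

end tapes

/-! ### Simulation of an o-machine, with a toss in every step -/

namespace AskingMachine

variable (M : AskingMachine)

instance : Primcodable M.Γ := .ofEquiv _ (Finite.equivFin M.Γ)

instance : Primcodable M.Λ := .ofEquiv _ (Finite.equivFin M.Λ)

/-- A configuration with the tape given by two lists. -/
abbrev ListCfg : Type := M.Λ × List M.Γ × List M.Γ

def ListCfg.toCfg {M : AskingMachine} (c : M.ListCfg) : M.Cfg := ⟨c.1, listTape c.2.1 c.2.2⟩

/-- The table, with moves coded by `Bool`. -/
def tableCode (q : M.Λ) (a : M.Γ) : Option (M.Λ × (Bool ⊕ M.Γ)) :=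
  (M.table q a).map fun r => (r.1, match r.2 with
    | .move .left => .inl false
    | .move .right => .inl true
    | .write b => .inr b)

/-- The effect of a coded move or of a written symbol. -/
def act (s : Bool ⊕ M.Γ) (T : List M.Γ × List M.Γ) : List M.Γ × List M.Γ :=
  Sum.casesOn s
    (fun d => bif d then (T.2.headI :: T.1, T.2.tail) else (T.1.tail, T.1.headI :: T.2))
    (fun b => (T.1, b :: T.2.tail))

def listStep (c : M.ListCfg) : Option M.ListCfg :=
  (M.tableCode c.1 c.2.2.headI).map fun r => (r.1, M.act r.2 c.2)

theorem listStep_map_toCfg (c : M.ListCfg) :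
    (M.listStep c).map ListCfg.toCfg = TM0.step M.table c.toCfg := by
  obtain ⟨q, L, R⟩ := c
  simp only [listStep, tableCode, TM0.step, ListCfg.toCfg, listTape_head, Option.map_map]
  refine Option.map_congr fun r _ => ?_
  obtain ⟨q', (_ | _) | b⟩ := r <;> simp [act, ListCfg.toCfg]

theorem primrec_act : Primrec₂ M.act := by
  have hL : Primrec fun x : ((Bool ⊕ M.Γ) × List M.Γ × List M.Γ) × Bool => x.1.2.1 :=
    Primrec.fst.comp (Primrec.snd.comp Primrec.fst)
  have hR : Primrec fun x : ((Bool ⊕ M.Γ) × List M.Γ × List M.Γ) × Bool => x.1.2.2 :=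
    Primrec.snd.comp (Primrec.snd.comp Primrec.fst)
  exact Primrec.sumCasesOn Primrec.fst
    (Primrec.cond Primrec.snd
      (Primrec.pair (Primrec.list_cons.comp (Primrec.list_headI.comp hR) hL)
        (Primrec.list_tail.comp hR))
      (Primrec.pair (Primrec.list_tail.comp hL)
        (Primrec.list_cons.comp (Primrec.list_headI.comp hL) hR))).to₂
    (Primrec.pair (Primrec.fst.comp (Primrec.snd.comp Primrec.fst))
      (Primrec.list_cons.comp Primrec.snd
        (Primrec.list_tail.comp (Primrec.snd.comp (Primrec.snd.comp Primrec.fst))))).to₂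

theorem primrec_listStep : Primrec M.listStep := by
  refine Primrec.option_map ((Primrec.dom_finite fun x : M.Λ × M.Γ => M.tableCode x.1 x.2).comp
    (Primrec.pair Primrec.fst (Primrec.list_headI.comp (Primrec.snd.comp Primrec.snd)))) ?_
  exact (Primrec.pair (Primrec.fst.comp Primrec.snd)
    (M.primrec_act.comp (Primrec.snd.comp Primrec.snd) (Primrec.snd.comp Primrec.fst))).to₂

end AskingMachine

namespace OMachine

variable (M : OMachine)

/-- The question on the tape. -/
def question (c : M.ListCfg) : Option ℕ :=
  gap (c.2.1.reverse ++ c.2.2) M.mark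

theorem query_iff (c : M.ListCfg) (n : ℕ) : M.Query c.toCfg.Tape n ↔ M.question c = some n :=
  exists_nth_eq_iff M.mark_ne_blank _ _ _

theorem primrec_question : Primrec M.question :=
  primrec_gap.comp (Primrec.list_append.comp
    (Primrec.list_reverse.comp (Primrec.fst.comp Primrec.snd)) (Primrec.snd.comp Primrec.snd))
    (Primrec.const M.mark)

/-- A configuration of the simulated machine, the number `j` that controls the probability of
error, the number of tosses and the number of heads. -/
abbrev SimState : Type := M.ListCfg × ℕ × ℕ × ℕ

/-- A decision on the membership of the number `n` in the oracle set: the arguments are `j`,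
the number of tosses, the number of heads and `n`. -/
abbrev _root_.BiasedCoin.Decision : Type := ℕ × ℕ × ℕ × ℕ → Option Bool

variable (D : Decision)

/-- The next configuration, when the numbers are `v`. -/
def simCfg (c : M.ListCfg) (v : ℕ × ℕ × ℕ) : Option M.ListCfg :=
  open Classical in
  if c.1 = M.ask then
    Option.casesOn (M.question c) (some (M.zero, c.2)) fun n =>
      some (Option.casesOn (D (v.1, v.2.1, v.2.2, n)) c fun b =>
        (bif b then M.one else M.zero, c.2))
  else M.listStep c

/-- The numbers after a toss. -/
def tally (v : ℕ × ℕ × ℕ) (b : Bool) : ℕ × ℕ × ℕ :=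
  (v.1, v.2.1 + 1, v.2.2 + b.toNat)

def simStep (s : M.SimState) (b : Bool) : Option M.SimState :=
  (M.simCfg D s.1 (tally s.2 b)).map fun c => (c, tally s.2 b)

theorem primrec_tally : Primrec₂ tally :=
  (Primrec.pair (Primrec.fst.comp Primrec.fst) (Primrec.pair
    (Primrec.succ.comp (Primrec.fst.comp (Primrec.snd.comp Primrec.fst)))
    (Primrec.nat_add.comp (Primrec.snd.comp (Primrec.snd.comp Primrec.fst))
      ((Primrec.dom_finite Bool.toNat).comp Primrec.snd)))).to₂

variable {D}

theorem primrec_simCfg (hD : Primrec D) : Primrec₂ (M.simCfg D) := by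
  classical
  refine Primrec.ite (Primrec.eq.comp (Primrec.fst.comp Primrec.fst) (Primrec.const M.ask)) ?_
    (M.primrec_listStep.comp Primrec.fst)
  have hT : Primrec fun x : M.ListCfg × ℕ × ℕ × ℕ => x.1.2 := Primrec.snd.comp Primrec.fst
  refine Primrec.option_casesOn (M.primrec_question.comp Primrec.fst)
    (Primrec.option_some.comp (Primrec.pair (Primrec.const M.zero) hT)) ?_
  have hv : Primrec fun x : (M.ListCfg × ℕ × ℕ × ℕ) × ℕ => x.1.2 := Primrec.snd.comp Primrec.fst
  have hd : Primrec fun x : (M.ListCfg × ℕ × ℕ × ℕ) × ℕ =>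
      D (x.1.2.1, x.1.2.2.1, x.1.2.2.2, x.2) :=
    hD.comp (Primrec.pair (Primrec.fst.comp hv) (Primrec.pair (Primrec.fst.comp
      (Primrec.snd.comp hv)) (Primrec.pair (Primrec.snd.comp (Primrec.snd.comp hv)) Primrec.snd)))
  have ha : Primrec₂ fun (x : (M.ListCfg × ℕ × ℕ × ℕ) × ℕ) (b : Bool) =>
      ((bif b then M.one else M.zero, x.1.1.2) : M.ListCfg) :=
    (Primrec.pair (Primrec.cond Primrec.snd (Primrec.const M.one) (Primrec.const M.zero))
      (hT.comp (Primrec.fst.comp Primrec.fst))).to₂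
  exact (Primrec.option_some.comp
    (Primrec.option_casesOn hd (Primrec.fst.comp Primrec.fst) ha)).to₂

theorem primrec_simStep (hD : Primrec D) : Primrec₂ (M.simStep D) := by
  have ht : Primrec fun x : M.SimState × Bool => tally x.1.2 x.2 :=
    primrec_tally.comp (Primrec.snd.comp Primrec.fst) Primrec.snd
  exact Primrec.option_map ((M.primrec_simCfg hD).comp (Primrec.fst.comp Primrec.fst) ht)
    (Primrec.pair Primrec.snd (ht.comp Primrec.fst)).to₂

end OMachine

/-- A simulation of a machine that never halts does not halt. -/
theorem not_eval_dom_of_simulates {σ₁ σ₂ : Type*} {f₁ : σ₁ → Option σ₁} {f₂ : σ₂ → Option σ₂}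
    {r : σ₁ → σ₂ → Prop}
    (H : ∀ a b a', r a b → f₁ a = some a' → ∃ b', r a' b' ∧ Reaches₁ f₂ b b')
    {a : σ₁} {b : σ₂} (hab : r a b) (ha : ¬ (eval f₁ a).Dom) : ¬ (eval f₂ b).Dom := by
  -- Adding non-termination to the relation makes the clause about halting states vacuous.
  have hr : Respects f₁ f₂ fun a b => r a b ∧ ¬ (eval f₁ a).Dom := by
    rintro a b ⟨hab, ha⟩
    cases h : f₁ a with
    | none => exact absurd (Part.dom_iff_mem.2 ⟨a, mem_eval.2 ⟨.refl, h⟩⟩) ha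
    | some a' =>
      obtain ⟨b', hb', hbb'⟩ := H a b a' hab h
      exact ⟨b', ⟨hb', by rwa [← reaches_eval (.single h)]⟩, hbb'⟩
  rwa [tr_eval_dom hr ⟨hab, ha⟩]

theorem reaches_of_simulates {σ₁ σ₂ : Type*} {f₁ : σ₁ → Option σ₁} {f₂ : σ₂ → Option σ₂}
    {r : σ₁ → σ₂ → Prop}
    (H : ∀ a b a', r a b → f₁ a = some a' → ∃ b', r a' b' ∧ Reaches₁ f₂ b b')
    {a a' : σ₁} {b : σ₂} (hab : r a b) (ha : Reaches f₁ a a') :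
    ∃ b', r a' b' ∧ Reaches f₂ b b' := by
  induction ha with
  | refl => exact ⟨b, hab, .refl⟩
  | tail _ h ih =>
    obtain ⟨b', hb', hbb'⟩ := ih
    obtain ⟨b'', hb'', h'⟩ := H _ _ _ hb' h
    exact ⟨b'', hb'', hbb'.trans h'.to_reflTransGen⟩

/-- The number of heads among the first `n` tosses. -/
def heads (ω : ℕ → Bool) (n : ℕ) : ℕ :=
  ∑ i ∈ Finset.range n, (ω i).toNat

namespace OMachine

variable (M : OMachine) (D : Decision)

/-! ### The simulation as a function on words -/

/-- The leading `false` tells a state from the input, which begins with `true` because its first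
block is nonempty. The state itself is coded by the length of the rest. -/
def stateWord (s : M.SimState) : List Bool :=
  false :: (List.range (Encodable.encode s)).map fun _ => true

open Classical in
def tapeSymbol (b : Bool) : M.Γ := if b then M.stroke else default

/-- The first state, from the input. -/
def startState (u : List Bool) : M.SimState :=
  ((default, [], (u.drop (u.idxOf false + 1)).map M.tapeSymbol), u.idxOf false - 1, 0, 0)

open Classical in
/-- What can be read off the tape. -/
def outWord (c : M.ListCfg) : List Bool :=
  c.2.2.map fun a => decide (a = M.stroke)

/-- In a state round the first bit of `w` is the latest toss. The first bit of the result tells the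
loop whether to halt. The empty word is a dummy value for words that do not arise. -/
def simWord (w : List Bool) : List Bool :=
  List.casesOn w.tail [] fun a e =>
    bif a then false :: M.stateWord (M.startState w.tail)
    else Option.casesOn (Encodable.decode e.length : Option M.SimState) [] fun s =>
      Option.casesOn (M.simStep D s w.headI) (true :: M.outWord s.1)
        fun s' => false :: M.stateWord s'

theorem primrec_stateWord : Primrec M.stateWord :=
  Primrec.list_cons.comp (Primrec.const false)
    (Primrec.list_map (Primrec.list_range.comp Primrec.encode) (Primrec.const true).to₂)

theorem primrec_startState : Primrec M.startState := by
  have hi : Primrec fun u : List Bool => u.idxOf false :=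
    Primrec.list_idxOf.comp (Primrec.const false) Primrec.id
  exact Primrec.pair (Primrec.pair (Primrec.const default) (Primrec.pair (Primrec.const [])
    (Primrec.list_map (Primrec.list_drop.comp (Primrec.succ.comp hi) Primrec.id)
      ((Primrec.dom_finite M.tapeSymbol).comp Primrec.snd).to₂)))
    (Primrec.pair (Primrec.pred.comp hi) (Primrec.const (0, 0)))

theorem primrec_outWord : Primrec M.outWord := by
  classical
  exact Primrec.list_map (Primrec.snd.comp Primrec.snd)
    ((Primrec.dom_finite fun a : M.Γ => decide (a = M.stroke)).comp Primrec.snd).to₂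

variable {D}

theorem primrec_simWord (hD : Primrec D) : Primrec (M.simWord D) := by
  have h₁ : Primrec₂ fun (x : (List Bool × Bool × List Bool) × M.SimState) (s : M.SimState) =>
      false :: M.stateWord s :=
    (Primrec.list_cons.comp (Primrec.const false) (M.primrec_stateWord.comp Primrec.snd)).to₂
  have h₂ : Primrec₂ fun (x : List Bool × Bool × List Bool) (s : M.SimState) =>
      (Option.casesOn (M.simStep D s x.1.headI) (true :: M.outWord s.1)
        fun s' => false :: M.stateWord s' : List Bool) :=
    Primrec.option_casesOn ((M.primrec_simStep hD).comp Primrec.snd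
        (Primrec.list_headI.comp (Primrec.fst.comp Primrec.fst)))
      (Primrec.list_cons.comp (Primrec.const true)
        (M.primrec_outWord.comp (Primrec.fst.comp Primrec.snd))) h₁
  have h₃ : Primrec fun x : List Bool × Bool × List Bool =>
      (Option.casesOn (Encodable.decode x.2.2.length : Option M.SimState) [] fun s =>
        Option.casesOn (M.simStep D s x.1.headI) (true :: M.outWord s.1)
          fun s' => false :: M.stateWord s' : List Bool) :=
    Primrec.option_casesOn (Primrec.decode.comp
      (Primrec.list_length.comp (Primrec.snd.comp Primrec.snd))) (Primrec.const []) h₂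
  have h₄ : Primrec₂ fun (w : List Bool) (x : Bool × List Bool) =>
      bif x.1 then false :: M.stateWord (M.startState w.tail)
      else (Option.casesOn (Encodable.decode x.2.length : Option M.SimState) [] fun s =>
        Option.casesOn (M.simStep D s w.headI) (true :: M.outWord s.1)
          fun s' => false :: M.stateWord s' : List Bool) :=
    Primrec.cond (Primrec.fst.comp Primrec.snd)
      (Primrec.list_cons.comp (Primrec.const false) (M.primrec_stateWord.comp
        (M.primrec_startState.comp (Primrec.list_tail.comp Primrec.fst)))) h₃
  exact Primrec.list_casesOn Primrec.list_tail (Primrec.const []) h₄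

theorem simWord_stateWord (b : Bool) (s : M.SimState) :
    M.simWord D (b :: M.stateWord s) =
      Option.casesOn (M.simStep D s b) (true :: M.outWord s.1) fun s' => false :: M.stateWord s' := by
  have hd : (Encodable.decode ((List.range (Encodable.encode s)).map fun _ => true).length :
      Option M.SimState) = some s := by
    rw [List.length_map, List.length_range]
    exact Encodable.encodek s
  rw [simWord, List.tail_cons, stateWord]
  simp only [hd, cond_false, List.headI_cons]

theorem simWord_unary (b : Bool) (j : ℕ) (xs : List ℕ) :
    M.simWord D (b :: unary (j :: xs)) = false :: M.stateWord
      ((default, [], (unary xs).map M.tapeSymbol), j, 0, 0) := by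
  have hu : unary (j :: xs) = List.replicate (j + 1) true ++ false :: unary xs := by
    simp [unary]
  have hi : (unary (j :: xs)).idxOf false = j + 1 := by
    rw [hu, List.idxOf_append_of_notMem (by simp)]
    simp
  have hs : M.startState (unary (j :: xs)) =
      ((default, [], (unary xs).map M.tapeSymbol), j, 0, 0) := by
    rw [startState, hi, hu, List.append_cons, List.drop_left' (by simp), Nat.add_sub_cancel]
  rw [simWord, List.tail_cons, hs, hu, List.replicate_succ, List.cons_append]
  rfl

/-! ### Correctness of the simulation -/

variable {M}
variable (W : WordMachine (M.simWord D)) (ω : ℕ → Bool) (j : ℕ)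

/-- The configuration of the loop, after `t + 1` tosses, that simulates `c`. -/
def simRound (c : M.ListCfg) (t : ℕ) : W.LoopCfg × ℕ :=
  -- Toss number `t` is still the first bit of the word; it is counted only in the coming round.
  (W.roundCfg (ω t :: M.stateWord (c, j, t, heads ω t)), t + 1)

theorem simRound_reaches₁ {c c' : M.ListCfg} {t : ℕ}
    (h : M.simCfg D c (j, t + 1, heads ω (t + 1)) = some c') :
    Reaches₁ (W.loopStep ω) (simRound W ω j c t) (simRound W ω j c' (t + 1)) := by
  refine W.roundCfg_reaches₁ ω (t + 1) ?_
  have ht : tally (j, t, heads ω t) (ω t) = (j, t + 1, heads ω (t + 1)) := by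
    simp [tally, heads, Finset.sum_range_succ]
  rw [simWord_stateWord, simStep, ht, h]
  rfl

theorem simRound_eval {c : M.ListCfg} {t : ℕ}
    (h : M.simCfg D c (j, t + 1, heads ω (t + 1)) = none) :
    ∃ s ∈ eval (W.loopStep ω) (simRound W ω j c t),
      ∃ L, s.1.Tape = listTape L ((M.outWord c).map W.bit) := by
  have ht : tally (j, t, heads ω t) (ω t) = (j, t + 1, heads ω (t + 1)) := by
    simp [tally, heads, Finset.sum_range_succ]
  obtain ⟨L, hL⟩ := W.roundCfg_eval ω (t + 1) (w := ω t :: M.stateWord (c, j, t, heads ω t))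
    (w' := M.outWord c) (by rw [simWord_stateWord, simStep, ht, h]; rfl)
  exact ⟨_, hL, L, rfl⟩

/-- The decisions on `X` are correct and are taken again and again. -/
def Reliable (D : Decision) (X : Set ℕ) (ω : ℕ → Bool) (j : ℕ) : Prop :=
  (∀ N n b, D (j, N, heads ω N, n) = some b → (b = true ↔ n ∈ X)) ∧
    ∀ n N₀, ∃ N ≥ N₀, (D (j, N, heads ω N, n)).isSome

variable {W ω j} {X : Set ℕ}

/-- While no decision is available, the simulated machine stays at its question and the rounds only
collect tosses. Reliability bounds the wait: induction on the distance to some time at which a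
decision is available. -/
theorem simRound_reaches₁_answer (h : Reliable D X ω j) {c : M.ListCfg} {n : ℕ}
    (hc : c.1 = M.ask) (hn : M.question c = some n) (t : ℕ) :
    ∃ t', Reaches₁ (W.loopStep ω) (simRound W ω j c t)
      (simRound W ω j (open Classical in if n ∈ X then M.one else M.zero, c.2) t') := by
  classical
  obtain ⟨N, hN, hd⟩ := h.2 n (t + 1)
  obtain ⟨k, rfl⟩ := Nat.exists_eq_add_of_le hN
  have step : ∀ t d, D (j, t + 1, heads ω (t + 1), n) = d →
      M.simCfg D c (j, t + 1, heads ω (t + 1)) =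
        some (Option.casesOn d c fun b => (bif b then M.one else M.zero, c.2)) := by
    intro t d hd
    simp [simCfg, hc, hn, hd]
  have decided : ∀ t b, D (j, t + 1, heads ω (t + 1), n) = some b →
      Reaches₁ (W.loopStep ω) (simRound W ω j c t)
        (simRound W ω j (if n ∈ X then M.one else M.zero, c.2) (t + 1)) := by
    intro t b hb
    refine simRound_reaches₁ W ω j ((step t _ hb).trans ?_)
    have := h.1 _ _ _ hb
    cases b <;> simp_all
  induction k generalizing t with
  | zero =>
    obtain ⟨b, hb⟩ := Option.isSome_iff_exists.1 hd
    exact ⟨_, decided t b hb⟩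
  | succ k ih =>
    cases hb : D (j, t + 1, heads ω (t + 1), n) with
    | some b => exact ⟨_, decided t b hb⟩
    | none =>
      obtain ⟨t', ht'⟩ := ih (t + 1) (by omega) (by rwa [show t + 1 + 1 + k = t + 1 + (k + 1) by omega])
      exact ⟨t', Relation.TransGen.trans (simRound_reaches₁ W ω j (step t _ hb)) ht'⟩

theorem simulates (h : Reliable D X ω j) (a : M.Cfg) (b : W.LoopCfg × ℕ) (a' : M.Cfg)
    (hab : ∃ c t, a = AskingMachine.ListCfg.toCfg c ∧ b = simRound W ω j c t)
    (ha : M.step X a = some a') :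
    ∃ b', (∃ c t, a' = AskingMachine.ListCfg.toCfg c ∧ b' = simRound W ω j c t) ∧
      Reaches₁ (W.loopStep ω) b b' := by
  classical
  obtain ⟨c, t, rfl, rfl⟩ := hab
  by_cases hc : c.1 = M.ask
  · have hs : M.step X c.toCfg =
        some ⟨if ∃ n ∈ X, M.question c = some n then M.one else M.zero, c.toCfg.Tape⟩ := by
      simp only [OMachine.step, AskingMachine.step, query_iff]
      exact if_pos hc
    obtain rfl := Option.some.inj (ha.symm.trans hs)
    cases hn : M.question c with
    | none =>
      refine ⟨_, ⟨(M.zero, c.2), t + 1, ?_, rfl⟩, simRound_reaches₁ W ω j ?_⟩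
      · simp [AskingMachine.ListCfg.toCfg]
      · simp [simCfg, hc, hn]
    | some n =>
      obtain ⟨t', ht'⟩ := simRound_reaches₁_answer (W := W) h hc hn t
      refine ⟨_, ⟨_, t', ?_, rfl⟩, ht'⟩
      simp [AskingMachine.ListCfg.toCfg]
  · have hs : M.step X c.toCfg = TM0.step M.table c.toCfg := by
      simp only [OMachine.step, AskingMachine.step]
      exact if_neg hc
    rw [hs, ← AskingMachine.listStep_map_toCfg] at ha
    obtain ⟨c', hc', rfl⟩ := Option.map_eq_some_iff.1 ha
    exact ⟨_, ⟨c', t + 1, rfl, rfl⟩, simRound_reaches₁ W ω j (by simp [simCfg, hc, hc'])⟩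

theorem simRound_eval_of_halts {c : M.ListCfg} (t : ℕ) (hc : M.step X c.toCfg = none) :
    ∃ s ∈ eval (W.loopStep ω) (simRound W ω j c t),
      ∀ ys, M.Reads c.toCfg.Tape ys → W.loop.Reads s.1.Tape ys := by
  classical
  have hq : c.1 ≠ M.ask := by
    intro hq
    have : M.step X c.toCfg ≠ none := by
      simp only [OMachine.step, AskingMachine.step]
      rw [if_pos (show c.toCfg.q = M.ask from hq)]
      simp
    exact this hc
  have hs : M.step X c.toCfg = TM0.step M.table c.toCfg := by
    simp only [OMachine.step, AskingMachine.step]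
    exact if_neg hq
  rw [hs, ← AskingMachine.listStep_map_toCfg, Option.map_eq_none_iff] at hc
  obtain ⟨s, hs, L, hL⟩ := simRound_eval W ω j (c := c) (t := t) (by simp [simCfg, hq, hc])
  refine ⟨s, hs, fun ys hys => ?_⟩
  rw [hL]
  refine (W.listTape_reads L _ ys).2 fun i hi => ?_
  rw [← hys i hi]
  simp only [AskingMachine.ListCfg.toCfg, listTape_nth, outWord, List.getElem?_map]
  cases c.2.2[i]? with
  | none => simpa using M.stroke_ne_blank.symm
  | some a => simp

theorem init_reaches_simRound (j : ℕ) (xs : List ℕ) :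
    ∃ c t, M.init xs = AskingMachine.ListCfg.toCfg c ∧
      Reaches (W.loopStep ω) ((W.loop.init (j :: xs) : W.LoopCfg), 0) (simRound W ω j c t) := by
  refine ⟨(default, [], (unary xs).map M.tapeSymbol), 0, rfl, ?_⟩
  refine (W.init_reaches ω 0 (j :: xs)).trans ?_
  -- The first round only decodes the input; its toss, number `0`, becomes the first bit, and no
  -- toss has been counted yet.
  have := W.roundCfg_reaches₁ ω 0 (M.simWord_unary (D := D) false j xs)
  exact this.to_reflTransGen

/-- The claim is pointwise in `ω`: all probability is confined to the event `Reliable`, and the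
machine depends neither on `j` nor on `ω`. -/
theorem exists_ptm (M : OMachine) (X : Set ℕ) {D : Decision} (hD : Primrec D) :
    ∃ P : PTM, ∀ ω j, Reliable D X ω j → ∀ xs,
      (∀ ys, M.Outputs X xs ys → P.Outputs ω (j :: xs) ys) ∧
      (¬ M.Halts X xs → ¬ P.Halts ω (j :: xs)) := by
  obtain ⟨W⟩ := nonempty_wordMachine (M.primrec_simWord hD).to_comp
  refine ⟨W.loop, fun ω j h xs => ?_⟩
  obtain ⟨c, t, hc, hreach⟩ := init_reaches_simRound (W := W) (ω := ω) j xs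
  constructor
  · rintro ys ⟨a, ha, hys⟩
    obtain ⟨ha, ha'⟩ := mem_eval.1 ha
    obtain ⟨b, ⟨c', t', rfl, rfl⟩, hb⟩ := reaches_of_simulates (simulates h) ⟨c, t, hc, rfl⟩ ha
    obtain ⟨s, hs, hread⟩ := simRound_eval_of_halts (W := W) (ω := ω) (j := j) t' ha'
    refine ⟨s, ?_, hread ys hys⟩
    rw [W.loop_step ω]
    rwa [← reaches_eval (hreach.trans hb)] at hs
  · intro hM
    have := not_eval_dom_of_simulates (simulates (W := W) h) ⟨c, t, hc, rfl⟩ hM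
    rw [PTM.Halts, W.loop_step ω]
    rwa [← reaches_eval hreach] at this

end OMachine

open OMachine

/-! ### Frequencies of heads -/

section probability

variable (p : unitInterval)

instance : IsProbabilityMeasure (tosses p) := by
  unfold tosses; infer_instance

/-- The outcome of toss number `i` as a real number. -/
def toss (i : ℕ) (ω : ℕ → Bool) : ℝ := ((ω i).toNat : ℝ)

theorem measurable_toss (i : ℕ) : Measurable (toss i) :=
  (measurable_from_top (f := fun b : Bool => (b.toNat : ℝ))).comp (measurable_pi_apply i)

theorem toss_mem_Icc (i : ℕ) (ω : ℕ → Bool) : toss i ω ∈ Set.Icc (0 : ℝ) 1 := by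
  unfold toss; cases ω i <;> simp

theorem memLp_toss (i : ℕ) : MemLp (toss i) 2 (tosses p) :=
  memLp_of_bounded (.of_forall (toss_mem_Icc i)) (measurable_toss i).aestronglyMeasurable 2

theorem integral_toss (i : ℕ) : (tosses p)[toss i] = (p : ℝ) := by
  have h := (measurePreserving_eval_infinitePi (fun _ : ℕ => bernoulliMeasure true false p) i)
  have hm := integral_map (μ := tosses p) (measurable_pi_apply i).aemeasurable
    (f := fun b : Bool => (b.toNat : ℝ)) measurable_from_top.aestronglyMeasurable
  refine hm.symm.trans ?_
  rw [show (tosses p).map (fun ω : ℕ → Bool => ω i) = bernoulliMeasure true false p from h.map_eq,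
    integral_bernoulliMeasure]
  simp

theorem sum_toss (n : ℕ) (ω : ℕ → Bool) : (∑ i ∈ Finset.range n, toss i) ω = heads ω n := by
  simp [toss, heads]

theorem variance_sum_toss_le (n : ℕ) :
    Var[∑ i ∈ Finset.range n, toss i; tosses p] ≤ n / 4 := by
  rw [IndepFun.variance_sum (fun i _ => memLp_toss p i)]
  · refine (Finset.sum_le_card_nsmul _ _ (1 / 4) fun i _ => ?_).trans_eq ?_
    · refine (variance_le_sq_of_bounded (.of_forall (toss_mem_Icc i))
        (measurable_toss i).aemeasurable).trans_eq (by norm_num)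
    · simp; ring
  · intro i _ j _ hij
    exact (iIndepFun_infinitePi (P := fun _ : ℕ => bernoulliMeasure true false p)
      (X := fun _ (b : Bool) => (b.toNat : ℝ)) fun _ => measurable_from_top).indepFun hij

theorem integral_sum_toss (n : ℕ) :
    (tosses p)[∑ i ∈ Finset.range n, toss i] = n * (p : ℝ) := by
  simp_rw [Finset.sum_apply]
  rw [integral_finsetSum _ fun i _ => (memLp_toss p i).integrable (by norm_num)]
  simp [integral_toss]

/-- Chebyshev: the variance is at most `8 ^ s / 4`, and dividing by `(4 ^ s) ^ 2` leaves `2 ^ (-s) /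
4`. The powers `8` and `4` make the relative error `2 ^ (-s)` vanish while the failure probabilities
stay summable. -/
theorem measure_heads_le (s : ℕ) :
    tosses p {ω | (4 : ℝ) ^ s ≤ |heads ω (8 ^ s) - 8 ^ s * (p : ℝ)|} ≤
      ENNReal.ofReal ((1 / 2) ^ s / 4) := by
  have h := meas_ge_le_variance_div_sq
    (memLp_finsetSum' (Finset.range (8 ^ s)) fun i _ => memLp_toss p i)
    (show (0 : ℝ) < 4 ^ s by positivity)
  rw [integral_sum_toss] at h
  simp only [sum_toss] at h
  push_cast at h
  refine h.trans (ENNReal.ofReal_le_ofReal ?_)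
  refine (div_le_div_of_nonneg_right (variance_sum_toss_le p _) (by positivity)).trans_eq ?_
  push_cast
  rw [← pow_mul, mul_comm s 2, pow_mul, div_pow, one_pow]
  have : (8 : ℝ) ^ s * 2 ^ s = (4 ^ 2) ^ s := by rw [← mul_pow]; norm_num
  field_simp
  linarith

/-- From some time on, the frequency of heads is close to the probability of heads. -/
def Typical (j : ℕ) (ω : ℕ → Bool) : Prop :=
  ∀ s > j, |heads ω (8 ^ s) - 8 ^ s * (p : ℝ)| < 4 ^ s

/-- Union bound over `s > j`: the geometric tail sums to `2 ^ (-j) / 4`, and the spare factor `1 /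
4` gives the strict inequality. -/
theorem lt_measureReal_typical (j : ℕ) :
    1 - 1 / 2 ^ j < (tosses p).real {ω | Typical p j ω} := by
  let B : ℕ → Set (ℕ → Bool) := fun k =>
    {ω | (4 : ℝ) ^ (j + 1 + k) ≤ |heads ω (8 ^ (j + 1 + k)) - 8 ^ (j + 1 + k) * (p : ℝ)|}
  have hB : ∀ k, MeasurableSet (B k) := by
    intro k
    have : Measurable fun ω : ℕ → Bool => (heads ω (8 ^ (j + 1 + k)) : ℝ) := by
      simp_rw [← sum_toss, Finset.sum_apply]
      exact Finset.measurable_sum _ fun i _ => measurable_toss i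
    exact measurableSet_le measurable_const (by fun_prop)
  have hT : {ω | Typical p j ω} = (⋃ k, B k)ᶜ := by
    ext ω
    simp only [Typical, Set.mem_ofPred_eq, Set.mem_compl_iff, Set.mem_iUnion, not_exists, B, not_le]
    constructor
    · exact fun h k => h _ (by omega)
    · intro h s hs
      obtain ⟨k, rfl⟩ := Nat.exists_eq_add_of_le hs
      exact h k
  have hsum : HasSum (fun k : ℕ => ((1 : ℝ) / 2) ^ (j + 1 + k) / 4) (1 / 2 ^ j / 4) := by
    have := ((hasSum_geometric_two).mul_left (((1 : ℝ) / 2) ^ (j + 1))).div_const 4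
    have hv : ((1 : ℝ) / 2) ^ (j + 1) * 2 = 1 / 2 ^ j := by
      rw [pow_succ, mul_assoc, one_div_mul_cancel two_ne_zero, mul_one, one_div_pow]
    rw [hv] at this
    simpa only [pow_add _ (j + 1)] using this
  have hle : tosses p (⋃ k, B k) ≤ ENNReal.ofReal (1 / 2 ^ j / 4) := by
    refine (measure_iUnion_le _).trans ((ENNReal.tsum_le_tsum fun k => measure_heads_le p _).trans ?_)
    rw [← ENNReal.ofReal_tsum_of_nonneg (fun _ => by positivity) hsum.summable, hsum.tsum_eq]
  rw [hT, probReal_compl_eq_one_sub (MeasurableSet.iUnion hB)]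
  have := ENNReal.toReal_le_of_le_ofReal (by positivity) hle
  have h0 : (0 : ℝ) < 1 / 2 ^ j := by positivity
  rw [measureReal_def]
  linarith

end probability

/-! ### Binary digits -/

section digits

variable (X : Set ℕ)

open Classical in
/-- The natural number with the binary digits of `bias X` up to digit number `n`. -/
def truncation (n : ℕ) : ℕ :=
  ∑ i ∈ Finset.range (n + 1), (if i ∈ X then 1 else 0) * 2 ^ (n - i)

theorem truncation_mod_two (n : ℕ) : truncation X n % 2 = 1 ↔ n ∈ X := by
  classical
  have : ∀ i ∈ Finset.range n, 2 ∣ (if i ∈ X then 1 else 0) * 2 ^ (n - i) := fun i hi =>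
    Dvd.dvd.mul_left (dvd_pow_self 2 (by have := Finset.mem_range.1 hi; omega)) _
  obtain ⟨k, hk⟩ := Finset.dvd_sum this
  rw [truncation, Finset.sum_range_succ, hk, Nat.sub_self, pow_zero, mul_one]
  split_ifs with h <;> simp [h]

variable {X}

theorem ofDigits_pos {a : ℕ → Fin 2} {i : ℕ} (h : a i = 1) : 0 < Real.ofDigits a := by
  refine Real.summable_ofDigitsTerm.tsum_pos (fun _ => Real.ofDigitsTerm_nonneg) i ?_
  simp [Real.ofDigitsTerm, h]

theorem ofDigits_lt_one {a : ℕ → Fin 2} {i : ℕ} (h : a i = 0) : Real.ofDigits a < 1 := by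
  rw [← Real.ofDigits_const_last_eq_one 1]
  refine Summable.tsum_lt_tsum (i := i) (fun n => ?_) ?_ Real.summable_ofDigitsTerm
    Real.summable_ofDigitsTerm
  · refine Real.ofDigitsTerm_le.trans_eq ?_
    simp [Real.ofDigitsTerm]
    norm_num
  · simp [Real.ofDigitsTerm, h]

open Classical in
theorem two_pow_mul_bias (n : ℕ) : 2 ^ (n + 1) * (bias X : ℝ) = truncation X n +
    Real.ofDigits (b := 2) fun i => if i + (n + 1) ∈ X then 1 else 0 := by
  have h := Real.ofDigits_eq_sum_add_ofDigits (b := 2) (fun n => if n ∈ X then 1 else 0) (n + 1)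
  rw [show (bias X : ℝ) = _ from h, mul_add, ← mul_assoc, Nat.cast_ofNat, mul_inv_cancel₀ (by positivity), one_mul,
    truncation, Finset.mul_sum]
  push_cast
  congr 1
  refine Finset.sum_congr rfl fun i hi => ?_
  obtain ⟨k, rfl⟩ := Nat.exists_eq_add_of_le (Nat.lt_succ_iff.1 (Finset.mem_range.1 hi))
  rw [Real.ofDigitsTerm, Nat.add_sub_cancel_left, Nat.cast_ofNat, add_right_comm, pow_add]
  split_ifs <;> simp
  field_simp

/-- Some digit after number `n` is one, so the remainder is positive. With `lt_truncation_add_one`,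
this keeps the bias off the ends of its dyadic interval. -/
theorem truncation_lt (hX : X.Infinite) (n : ℕ) :
    (truncation X n : ℝ) < 2 ^ (n + 1) * (bias X : ℝ) := by
  classical
  obtain ⟨m, hm, hn⟩ := hX.exists_gt n
  rw [two_pow_mul_bias, lt_add_iff_pos_right]
  refine ofDigits_pos (i := m - (n + 1)) ?_
  rw [Nat.sub_add_cancel hn, if_pos hm]

theorem lt_truncation_add_one (hX : Xᶜ.Infinite) (n : ℕ) :
    2 ^ (n + 1) * (bias X : ℝ) < truncation X n + 1 := by
  classical
  obtain ⟨m, hm, hn⟩ := hX.exists_gt n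
  rw [two_pow_mul_bias, add_lt_add_iff_left]
  refine ofDigits_lt_one (i := m - (n + 1)) ?_
  rw [Nat.sub_add_cancel hn, if_neg hm]

end digits

/-! ### Decisions from the frequency of heads -/

/-- The exponent of the greatest power of `8` that is at most `N`. -/
def expEight (N : ℕ) : ℕ :=
  N.findGreatest fun s => 8 ^ s ≤ N

theorem expEight_pow (s : ℕ) : expEight (8 ^ s) = s := by
  refine Nat.findGreatest_eq_iff.2 ⟨(Nat.lt_pow_self (by norm_num)).le, fun _ => le_rfl, ?_⟩
  intro t hst _ ht
  exact absurd ((Nat.pow_le_pow_iff_right (by norm_num)).1 ht) (by omega)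

/-- With `h` heads among `8 ^ s` tosses, an estimate of the binary digits up to number `n`. -/
def estimate (s h n : ℕ) : ℕ :=
  -- The digits are taken from the lower end of the interval of radius `2 ^ (-s)` around the
  -- frequency; truncated subtraction cuts that end off at zero.
  2 ^ (n + 1) * (h - 4 ^ s) / 8 ^ s

/-- After `8 ^ s` tosses with `j < s`, the digit number `n` is decided if it is the same for all
numbers that are close to the frequency of heads. -/
def digitDecision : Decision := fun v =>
  if 8 ^ expEight v.2.1 = v.2.1 ∧ v.1 < expEight v.2.1 ∧
      2 ^ (v.2.2.2 + 1) * (v.2.2.1 + 4 ^ expEight v.2.1) <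
        (estimate (expEight v.2.1) v.2.2.1 v.2.2.2 + 1) * 8 ^ expEight v.2.1 then
    some (estimate (expEight v.2.1) v.2.2.1 v.2.2.2 % 2 == 1)
  else none

theorem primrec_pow : Primrec₂ ((· ^ ·) : ℕ → ℕ → ℕ) :=
  Primrec₂.unpaired'.1 Nat.Primrec.pow

theorem primrec_expEight : Primrec expEight :=
  Primrec.nat_findGreatest Primrec.id
    (Primrec.nat_le.comp (primrec_pow.comp (Primrec.const 8) Primrec.snd) Primrec.fst)

theorem primrec_digitDecision : Primrec digitDecision := by
  have hs : Primrec fun v : ℕ × ℕ × ℕ × ℕ => expEight v.2.1 :=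
    primrec_expEight.comp (Primrec.fst.comp Primrec.snd)
  have hh : Primrec fun v : ℕ × ℕ × ℕ × ℕ => v.2.2.1 :=
    Primrec.fst.comp (Primrec.snd.comp Primrec.snd)
  have hn : Primrec fun v : ℕ × ℕ × ℕ × ℕ => 2 ^ (v.2.2.2 + 1) :=
    primrec_pow.comp (Primrec.const 2)
      (Primrec.succ.comp (Primrec.snd.comp (Primrec.snd.comp Primrec.snd)))
  have h4 := primrec_pow.comp (Primrec.const 4) hs
  have h8 := primrec_pow.comp (Primrec.const 8) hs
  have he : Primrec fun v : ℕ × ℕ × ℕ × ℕ => estimate (expEight v.2.1) v.2.2.1 v.2.2.2 :=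
    Primrec.nat_div.comp (Primrec.nat_mul.comp hn (Primrec.nat_sub.comp hh h4)) h8
  refine Primrec.ite (PrimrecPred.and (Primrec.eq.comp h8 (Primrec.fst.comp Primrec.snd))
    (PrimrecPred.and (Primrec.nat_lt.comp Primrec.fst hs) (Primrec.nat_lt.comp
      (Primrec.nat_mul.comp hn (Primrec.nat_add.comp hh h4))
      (Primrec.nat_mul.comp (Primrec.succ.comp he) h8)))) ?_ (Primrec.const none)
  exact Primrec.option_some.comp
    (Primrec.beq.comp (Primrec.nat_mod.comp he (Primrec.const 2)) (Primrec.const 1))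

theorem estimate_mul_le (s h n : ℕ) :
    (estimate s h n * 8 ^ s : ℝ) ≤ 2 ^ (n + 1) * ((h - 4 ^ s : ℕ) : ℝ) := by
  exact_mod_cast Nat.div_mul_le_self (2 ^ (n + 1) * (h - 4 ^ s)) (8 ^ s)

theorem sub_le_cast_sub (h k : ℕ) : (h - k : ℝ) ≤ ((h - k : ℕ) : ℝ) := by
  have : h ≤ h - k + k := by omega
  have : (h : ℝ) ≤ ((h - k : ℕ) : ℝ) + k := by exact_mod_cast this
  linarith

theorem cast_sub_le_of_le {h k : ℕ} {x : ℝ} (hx : 0 ≤ x) (hle : (h - k : ℝ) ≤ x) :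
    ((h - k : ℕ) : ℝ) ≤ x := by
  rcases le_total k h with hkh | hkh
  · rwa [Nat.cast_sub hkh]
  · simpa [Nat.sub_eq_zero_of_le hkh]

/-- Correctness: `p` lies in the interval around the frequency, so a decision forces the estimate to
be the integer part of `2 ^ (n + 1) * p`, whose parity is digit `n`. Recurrence: that real number is
not an integer, while the intervals shrink to a point. -/
theorem reliable_digitDecision {X : Set ℕ} (hX : X.Infinite) (hX' : Xᶜ.Infinite) {j : ℕ}
    {ω : ℕ → Bool} (h : Typical (bias X) j ω) : Reliable digitDecision X ω j := by
  set p : ℝ := (bias X).1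
  have hp0 : 0 ≤ p := (bias X).2.1
  constructor
  · intro N n b hb
    rw [digitDecision] at hb
    split_ifs at hb with hc
    obtain ⟨hN, hj, hlt⟩ := hc
    simp only at hN hj hlt
    obtain rfl := Option.some.inj hb
    generalize expEight N = s at *
    subst hN
    have hs := abs_lt.1 (h s hj)
    set q := estimate s (heads ω (8 ^ s)) n
    have h8 : (0 : ℝ) < 8 ^ s := by positivity
    have h2 : (0 : ℝ) < 2 ^ (n + 1) := by positivity
    have hlow : (q : ℝ) ≤ 2 ^ (n + 1) * p := by
      refine le_of_mul_le_mul_right ((estimate_mul_le _ _ _).trans ?_) h8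
      rw [mul_assoc]
      refine mul_le_mul_of_nonneg_left (cast_sub_le_of_le (by positivity) ?_) h2.le
      push_cast
      linarith
    have hhigh : 2 ^ (n + 1) * p < (q : ℝ) + 1 := by
      have hlt' : (2 : ℝ) ^ (n + 1) * (heads ω (8 ^ s) + 4 ^ s) < (q + 1) * 8 ^ s := by
        exact_mod_cast hlt
      refine lt_of_mul_lt_mul_right (lt_of_le_of_lt ?_ hlt') h8.le
      rw [mul_assoc]
      exact mul_le_mul_of_nonneg_left (by linarith) h2.le
    have h3 := truncation_lt hX n
    have h4 := lt_truncation_add_one hX' n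
    have e : q = truncation X n := by
      have h5 : (q : ℝ) < truncation X n + 1 := hlow.trans_lt h4
      have h6 : (truncation X n : ℝ) < q + 1 := h3.trans hhigh
      have h5' : q < truncation X n + 1 := by exact_mod_cast h5
      have h6' : truncation X n < q + 1 := by exact_mod_cast h6
      omega
    rw [beq_iff_eq, e, truncation_mod_two]
  · intro n N₀
    have h3 := truncation_lt hX n
    have h4 := lt_truncation_add_one hX' n
    set m := truncation X n
    -- `δ` is the distance from `2 ^ (n + 1) * p` to the nearest integer.
    obtain ⟨δ, hδ, h3', h4'⟩ : ∃ δ > 0, (m : ℝ) + δ ≤ 2 ^ (n + 1) * p ∧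
        2 ^ (n + 1) * p ≤ m + 1 - δ :=
      ⟨min (2 ^ (n + 1) * p - m) (m + 1 - 2 ^ (n + 1) * p), lt_min (by linarith) (by linarith),
        by linarith [min_le_left (2 ^ (n + 1) * p - m) (m + 1 - 2 ^ (n + 1) * p)],
        by linarith [min_le_right (2 ^ (n + 1) * p - m) (m + 1 - 2 ^ (n + 1) * p)]⟩
    -- The ends of the interval are within `2 * 2 ^ (-s)` of `p`: once for the error of the
    -- frequency, once for the radius. Scaling by `2 ^ (n + 1)` gives `2 ^ (n + 2) * 2 ^ (-s)`,
    -- which must not exceed `δ`.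
    obtain ⟨r, hr⟩ := pow_unbounded_of_one_lt (2 ^ (n + 2) / δ) (one_lt_two : (1 : ℝ) < 2)
    obtain ⟨s, hsr, hsj, hsN⟩ : ∃ s, r ≤ s ∧ j < s ∧ N₀ ≤ s := ⟨r + (j + 1) + N₀, by omega⟩
    have hr' : (2 : ℝ) ^ (n + 2) ≤ δ * 2 ^ s := by
      have := hr.le.trans (pow_le_pow_right₀ (one_le_two : (1 : ℝ) ≤ 2) hsr)
      rwa [div_le_iff₀ hδ, mul_comm] at this
    have h48 : (2 : ℝ) ^ (n + 2) * 4 ^ s ≤ δ * 8 ^ s := by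
      have : (8 : ℝ) ^ s = 2 ^ s * 4 ^ s := by rw [← mul_pow]; norm_num
      rw [this, ← mul_assoc]
      exact mul_le_mul_of_nonneg_right hr' (by positivity)
    have hs := abs_lt.1 (h s hsj)
    have h8 : (0 : ℝ) < 8 ^ s := by positivity
    have h2 : (0 : ℝ) < 2 ^ (n + 1) := by positivity
    have hmq : m ≤ estimate s (heads ω (8 ^ s)) n := by
      rw [estimate, Nat.le_div_iff_mul_le (by positivity)]
      have : (m * 8 ^ s : ℝ) ≤ 2 ^ (n + 1) * ((heads ω (8 ^ s) - 4 ^ s : ℕ) : ℝ) := by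
        have h5 := sub_le_cast_sub (heads ω (8 ^ s)) (4 ^ s)
        push_cast at h5
        have h6 := mul_le_mul_of_nonneg_right h3' h8.le
        have h7 : (2 : ℝ) ^ (n + 1) * (8 ^ s * p - 2 * 4 ^ s) ≤
            2 ^ (n + 1) * ((heads ω (8 ^ s) - 4 ^ s : ℕ) : ℝ) :=
          mul_le_mul_of_nonneg_left (by linarith) h2.le
        rw [pow_succ _ (n + 1)] at h48
        linarith
      exact_mod_cast this
    refine ⟨8 ^ s, hsN.trans (Nat.lt_pow_self (by norm_num)).le, ?_⟩
    rw [digitDecision, if_pos]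
    · rfl
    simp only [expEight_pow, true_and]
    refine ⟨hsj, lt_of_lt_of_le ?_ (Nat.mul_le_mul_right _ (Nat.succ_le_succ hmq))⟩
    have : (2 : ℝ) ^ (n + 1) * (heads ω (8 ^ s) + 4 ^ s) < (m + 1) * 8 ^ s := by
      have h6 := mul_le_mul_of_nonneg_right h4' h8.le
      have h7 : (2 : ℝ) ^ (n + 1) * (heads ω (8 ^ s) + 4 ^ s) <
          2 ^ (n + 1) * (8 ^ s * p + 2 * 4 ^ s) :=
        mul_lt_mul_of_pos_left (by linarith) h2
      rw [pow_succ _ (n + 1)] at h48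
      linarith
    exact_mod_cast this

/-! ### Finite and cofinite oracle sets -/

-- If `X` is finite or cofinite, the bias is dyadic and the intervals around the frequency may
-- straddle it forever. Membership in such an `X` is primitive recursive, so the tosses can be
-- ignored.
open Classical in
def finiteDecision (X : Set ℕ) : Decision := fun v => some (decide (v.2.2.2 ∈ X))

theorem primrecPred_mem_finite {X : Set ℕ} (hX : X.Finite) : PrimrecPred (· ∈ X) := by
  refine (Primrec.nat_lt.comp (Primrec.list_idxOf₁ hX.toFinset.toList)
    (Primrec.const hX.toFinset.toList.length)).of_eq fun n => ?_
  rw [List.idxOf_lt_length_iff]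
  simp

theorem primrec_finiteDecision {X : Set ℕ} (hX : X.Finite ∨ Xᶜ.Finite) :
    Primrec (finiteDecision X) := by
  classical
  have h : PrimrecPred (· ∈ X) := by
    rcases hX with hX | hX
    · exact primrecPred_mem_finite hX
    · exact (primrecPred_mem_finite hX).not.of_eq fun n => by simp
  exact Primrec.option_some.comp
    (h.decide.comp (Primrec.snd.comp (Primrec.snd.comp Primrec.snd)))

theorem reliable_finiteDecision (X : Set ℕ) (ω : ℕ → Bool) (j : ℕ) :
    Reliable (finiteDecision X) X ω j := by
  refine ⟨fun N n b hb => ?_, fun n N₀ => ⟨N₀, le_rfl, rfl⟩⟩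
  obtain rfl := Option.some.inj hb
  simp

theorem exists_reliable_decision (X : Set ℕ) : ∃ D : Decision, Primrec D ∧
    ∀ j, 1 - 1 / 2 ^ j < (tosses (bias X)).real {ω | Reliable D X ω j} := by
  by_cases hX : X.Finite ∨ Xᶜ.Finite
  · refine ⟨finiteDecision X, primrec_finiteDecision hX, fun j => ?_⟩
    simp only [reliable_finiteDecision]
    simp
  · rw [not_or] at hX
    exact ⟨digitDecision, primrec_digitDecision, fun j =>
      (lt_measureReal_typical (bias X) j).trans_le
        (measureReal_mono fun ω => reliable_digitDecision hX.1 hX.2)⟩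

end BiasedCoin

end

theorem mainTheorem2 (M : BiasedCoin.OMachine) (X : Set ℕ) :
    ∃ P : BiasedCoin.PTM, ∀ (j : ℕ) (xs : List ℕ),
      (∀ ys : List ℕ, M.Outputs X xs ys →
        1 - 1 / 2 ^ j < (BiasedCoin.tosses (BiasedCoin.bias X)).real {ω | P.Outputs ω (j :: xs) ys}) ∧
      (¬ M.Halts X xs →
        1 - 1 / 2 ^ j < (BiasedCoin.tosses (BiasedCoin.bias X)).real {ω | ¬ P.Halts ω (j :: xs)}) := by
  obtain ⟨D, hD, hmeas⟩ := BiasedCoin.exists_reliable_decision X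
  obtain ⟨P, hP⟩ := M.exists_ptm X hD
  refine ⟨P, fun j xs => ⟨fun ys hys => ?_, fun hM => ?_⟩⟩
  -- Monotonicity holds for arbitrary sets, so the events need not be shown measurable.
  · exact (hmeas j).trans_le (MeasureTheory.measureReal_mono fun ω hω => (hP ω j hω xs).1 ys hys)
  · exact (hmeas j).trans_le (MeasureTheory.measureReal_mono fun ω hω => (hP ω j hω xs).2 hM)
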